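/- **Discrete Korn inequality for space groups.** Let $E(d)$ be the group of isometries $g\cdot x=\mathrm{rot}(g)x+\mathrm{trans}(g)$ of $\mathbb R^d$, with $\mathrm{rot}(g)\in O(d)$ and $\mathrm{trans}(g)\in\mathbb R^d$. A *space group* in $E(d)$ is a subgroup all of whose orbits in $\mathbb R^d$ are discrete and which contains $d$ translations with linearly independent translation components. *Setting.* Let $d=d_1+d_2$, and let $\mathcal G<E(d)$ be a discrete group in normal form: every element of $\mathcal G$ is of the form $A\oplus s:(x,y)\mapsto(Ax,s\cdot y)$ with $A\in O(d_1)$, $s\in E(d_2)$, and the image $\mathcal S=\pi(\mathcal G)$ under $\pi(A\oplus s)=s$ is a space group in $E(d_2)$. Let $\mathcal T\subset\mathcal G$ be such that $\pi$ maps $\mathcal T$ bijectively onto the set of translations of $\mathcal S$. Put $\mathcal T^N=\{t^N: t\in\mathcal T\}$ and $M=\{N\ge1:\mathcal T^N\text{ is a normal subgroup of }\mathcal G\}$. A map $u:\mathcal G\to\mathbb R^d$ is $\mathcal T^N$-periodic if $u(gt)=u(g)$ for all $g\in\mathcal G$, $t\in\mathcal T^N$; $U_{\rm per}$ is the set of maps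 that are $\mathcal T^N$-periodic for some $N\in M$. For $N\in M$ let $\mathcal C_N$ be a representation set of $\mathcal G/\mathcal T^N$. Let $x_0\in\mathbb R^d$ be such that $g\mapsto g\cdot x_0$ is injective on $\mathcal G$. (A space group $\mathcal G$ has this form with $d_1=0$, $d_2=d$, $\mathcal S=\mathcal G$, $\mathcal T$ its subgroup of translations, and $M=\{1,2,\dots\}$.) *Seminorms.* Let $\mathcal R\subset\mathcal G$ be finite and equip $\{v:\mathcal R\to\mathbb R^d\}$ with the norm $\|v\|=(\sum_{h\in\mathcal R}\|v(h)\|^2)^{1/2}$. Let $U_{\rm trans}(\mathcal R)$ be the set of all $v$ for which there is $a\in\mathbb R^d$ with $\mathrm{rot}(h)v(h)=a$ for all $h\in\mathcal R$; let $U_{\rm rot}(\mathcal R)$ be the set of all $v$ for which there is $S\in\mathrm{Skew}(d)$ with $\mathrm{rot}(h)v(h)=S(h\cdot x_0-x_0)$ for all $h\in\mathcal R$; let $U_{\rm rot,0,0}(\mathcal R)$ be defined like $U_{\rm rot}(\mathcal R)$, but with $S$ restricted to the matrices $S'\oplus 0_{d_2,d_2}$, $S'\in\mathrm{Skew}(d_1)$.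 Put $U_{\rm iso}=U_{\rm trans}+U_{\rm rot}$ and $U_{\rm iso,0,0}=U_{\rm trans}+U_{\rm rot,0,0}$, and let $\pi_U$ be the orthogonal projection with kernel $U$. For $\mathcal T^N$-periodic $u$, $N\in M$, set $$\|u\|_{\mathcal R}=\Big(\tfrac1{|\mathcal C_N|}\sum_{g\in\mathcal C_N}\|\pi_{U_{\rm iso}(\mathcal R)}(u(g\,\cdot)|_{\mathcal R})\|^2\Big)^{1/2},\qquad \|u\|_{\mathcal R,0,0}=\Big(\tfrac1{|\mathcal C_N|}\sum_{g\in\mathcal C_N}\|\pi_{U_{\rm iso,0,0}(\mathcal R)}(u(g\,\cdot)|_{\mathcal R})\|^2\Big)^{1/2},$$ $$\|\nabla_{\mathcal R}u\|_2=\Big(\tfrac1{|\mathcal C_N|}\sum_{g\in\mathcal C_N}\sum_{h\in\mathcal R}\|u(gh)-\mathrm{rot}(h)^Tu(g)\|^2\Big)^{1/2}.$$ *Property 2.* A finite set $\mathcal R''\subset\mathcal G$ has Property 1 if $\mathrm{id}\in\mathcal R''$ and $\mathrm{aff}(\mathcal R''\cdot x_0)=\mathrm{aff}(\mathcal G\cdot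 x_0)$. A finite set $\mathcal R\subset\mathcal G$ has Property 2 if there are $\mathcal R',\mathcal R''\subset\mathcal G$ such that $\mathrm{id}\in\mathcal R'$, $\mathcal R'$ generates $\mathcal G$, $\mathcal R''$ has Property 1 and $\mathcal R'\mathcal R''\subset\mathcal R$. *Claim.* If $\mathcal G$ is a space group in $E(d)$ and $\mathcal R\subset\mathcal G$ has Property 2, then the seminorms $\|\cdot\|_{\mathcal R}$, $\|\cdot\|_{\mathcal R,0,0}$ and $\|\nabla_{\mathcal R}\,\cdot\|_2$ on $U_{\rm per}$ are pairwise equivalent: there are constants $c,K>0$, independent of $N\in M$, of $\mathcal C_N$ and of $u$, such that for every $N\in M$ and every $\mathcal T^N$-periodic $u:\mathcal G\to\mathbb R^d$ $$c\|u\|_{\mathcal R,0,0}\le\|u\|_{\mathcal R}\le K\|u\|_{\mathcal R,0,0},\qquad c\|\nabla_{\mathcal R}u\|_2\le\|u\|_{\mathcal R}\le K\|\nabla_{\mathcal R}u\|_2,\qquad c\|\nabla_{\mathcal R}u\|_2\le\|u\|_{\mathcal R,0,0}\le K\|\nabla_{\mathcal R}u\|_2 .$$ -/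

import Mathlib

open scoped Pointwise

noncomputable section

namespace DiscreteKorn

/-- The Euclidean space `ℝ^d`, written as column vectors. -/
abbrev Vec (d : ℕ) : Type := EuclideanSpace ℝ (Fin d)

/-- The Euclidean group `E(d)`: all isometries `x ↦ A x + b` of `ℝ^d` onto itself, with composition
as multiplication. -/
abbrev Euc (d : ℕ) : Type := Vec d ≃ᵃⁱ[ℝ] Vec d

/-- The linear component `A ∈ O(d)` of `x ↦ A x + b`. -/
def rot {d : ℕ} (g : Euc d) : Vec d ≃ₗᵢ[ℝ] Vec d := g.linearIsometryEquiv

/-- The translation component `b` of `x ↦ A x + b`. -/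
def transl {d : ℕ} (g : Euc d) : Vec d := g 0

/-- An isometry is a translation if its linear component is the identity. -/
def IsTranslation {d : ℕ} (g : Euc d) : Prop := rot g = 1

/-- A subgroup of `E(d)` is discrete if every orbit in `ℝ^d` is a discrete set. -/
def IsDiscreteGroup {d : ℕ} (G : Subgroup (Euc d)) : Prop :=
  ∀ x : Vec d, IsDiscrete (Set.range fun g : G => (g : Euc d) x)

/-- A `d`-dimensional space group: a discrete subgroup of `E(d)` that contains `d` translations with
linearly independent translation components. -/
structure IsSpaceGroup {d : ℕ} (G : Subgroup (Euc d)) : Prop where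
  discrete : IsDiscreteGroup G
  translations : ∃ t : Fin d → Euc d,
    (∀ i, t i ∈ G ∧ IsTranslation (t i)) ∧ LinearIndependent ℝ fun i => transl (t i)

section Decomposition

variable {d d₁ d₂ : ℕ} (hd : d₁ + d₂ = d)

/-- The vector `(x, y) ∈ ℝ^d` built from `x ∈ ℝ^{d₁}` and `y ∈ ℝ^{d₂}`, where `d = d₁ + d₂`. -/
def blockVec (x : Vec d₁) (y : Vec d₂) : Vec d :=
  WithLp.toLp 2 fun i => Fin.append x y (Fin.cast hd.symm i)

/-- The direct sum `A ⊕ B` of two square matrices, with rows and columns in `{1, …, d₁ + d₂}`. -/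
def matrixSum (A : Matrix (Fin d₁) (Fin d₁) ℝ) (B : Matrix (Fin d₂) (Fin d₂) ℝ) :
    Matrix (Fin d) (Fin d) ℝ :=
  (Matrix.fromBlocks A 0 0 B).reindex (finSumFinEquiv.trans (finCongr hd))
    (finSumFinEquiv.trans (finCongr hd))

/-- `g = A ⊕ s`: the isometry `g` of `ℝ^d` is `(x, y) ↦ (A x, s y)`. -/
def IsDirectSum (A : Vec d₁ ≃ₗᵢ[ℝ] Vec d₁) (s : Euc d₂) (g : Euc d) : Prop :=
  ∀ x y, g (blockVec hd x y) = blockVec hd (A x) (s y)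

/-- `g ∈ O(d₁) ⊕ E(d₂)` and `π(g) = s`, where `π (A ⊕ s) = s`. -/
def ProjectsTo (g : Euc d) (s : Euc d₂) : Prop :=
  ∃ A : Vec d₁ ≃ₗᵢ[ℝ] Vec d₁, IsDirectSum hd A s g

/-- The normal form of a discrete group `G < E(d)`: there is a splitting `d = d₁ + d₂` such that
`G < O(d₁) ⊕ S` for a `d₂`-dimensional space group `S` with `π(G) = S`. -/
structure IsNormalForm (G : Subgroup (Euc d)) (S : Subgroup (Euc d₂)) : Prop where
  discrete : IsDiscreteGroup G
  spaceGroup : IsSpaceGroup S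
  mapsTo : ∀ g ∈ G, ∃ s ∈ S, ProjectsTo hd g s
  surjective : ∀ s ∈ S, ∃ g ∈ G, ProjectsTo hd g s

/-- `T ⊆ G` is a section of the translation group `T_S` of `S`: the projection `π` restricts to a
bijection from `T` onto the set of translations in `S`. -/
structure IsTranslationSection (G : Subgroup (Euc d)) (S : Subgroup (Euc d₂)) (T : Set G) :
    Prop where
  mapsTo : ∀ t ∈ T, ∃ s ∈ S, IsTranslation s ∧ ProjectsTo hd (t : Euc d) s
  bijective : ∀ s ∈ S, IsTranslation s → ∃! t : G, t ∈ T ∧ ProjectsTo hd (t : Euc d) s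

end Decomposition

section Periodicity

variable {Γ : Type*} [Group Γ]

/-- The set `T^N = {t^N | t ∈ T}`. -/
def powSet (T : Set Γ) (N : ℕ) : Set Γ := (fun t => t ^ N) '' T

/-- The set `M` of all integers `N ≥ 1` for which `T^N` is a normal subgroup. -/
def admissiblePeriods (T : Set Γ) : Set ℕ :=
  {N | 1 ≤ N ∧ ∃ H : Subgroup Γ, H.Normal ∧ (H : Set Γ) = powSet T N}

/-- `u` is `T^N`-periodic. -/
def IsPeriodic {X : Type*} (T : Set Γ) (N : ℕ) (u : Γ → X) : Prop :=
  ∀ g, ∀ t ∈ powSet T N, u (g * t) = u g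

/-- `C` is a representation set of `Γ / T^N`: it contains exactly one element of each coset
`g T^N`. -/
def IsRepresentationSet (T : Set Γ) (N : ℕ) (C : Finset Γ) : Prop :=
  ∀ g, ∃! c, c ∈ C ∧ ∃ t ∈ powSet T N, g = c * t

/-- The quadratic mean `(|C|⁻¹ ∑_{g ∈ C} ‖w g‖²)^{1/2}`. If `w` is `T^N`-periodic and `C` is a
representation set of `Γ / T^N`, this is the norm `‖w‖₂`. -/
def meanNorm {V : Type*} [Norm V] (C : Finset Γ) (w : Γ → V) : ℝ :=
  Real.sqrt ((1 / (C.card : ℝ)) * ∑ g ∈ C, ‖w g‖ ^ 2)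

end Periodicity

/-- `Skew(n)`: the real `n × n` matrices `S` with `Sᵀ = -S`. -/
def skew (n : ℕ) : Submodule ℝ (Matrix (Fin n) (Fin n) ℝ) where
  carrier := {S | S.transpose = -S}
  add_mem' {A B} hA hB := by
    simp only [Set.mem_ofPred_eq] at hA hB ⊢
    rw [Matrix.transpose_add, hA, hB, neg_add]
  zero_mem' := by simp
  smul_mem' c A hA := by
    simp only [Set.mem_ofPred_eq] at hA ⊢
    rw [Matrix.transpose_smul, hA, smul_neg]

/-- The matrices `S ⊕ 0_{d₂,d₂}` with `S ∈ Skew(d₁)`. -/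
def skewZero {d d₁ d₂ : ℕ} (hd : d₁ + d₂ = d) : Submodule ℝ (Matrix (Fin d) (Fin d) ℝ) where
  carrier := {B | ∃ S ∈ skew d₁, B = matrixSum hd S 0}
  add_mem' := by
    rintro _ _ ⟨S, hS, rfl⟩ ⟨S', hS', rfl⟩
    refine ⟨S + S', add_mem hS hS', ?_⟩
    simp only [matrixSum, Matrix.reindex_apply]
    rw [← add_zero (0 : Matrix (Fin d₂) (Fin d₂) ℝ), ← add_zero (0 : Matrix (Fin d₁) (Fin d₂) ℝ),
      ← add_zero (0 : Matrix (Fin d₂) (Fin d₁) ℝ), ← Matrix.fromBlocks_add]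
    simp only [add_zero]
    rfl
  zero_mem' := ⟨0, zero_mem _, by
    simp only [matrixSum, Matrix.reindex_apply, Matrix.fromBlocks_zero]
    rfl⟩
  smul_mem' := by
    rintro c _ ⟨S, hS, rfl⟩
    refine ⟨c • S, Submodule.smul_mem _ c hS, ?_⟩
    simp only [matrixSum, Matrix.reindex_apply]
    rw [← smul_zero (A := Matrix (Fin d₂) (Fin d₂) ℝ) c,
      ← smul_zero (A := Matrix (Fin d₁) (Fin d₂) ℝ) c,
      ← smul_zero (A := Matrix (Fin d₂) (Fin d₁) ℝ) c, ← Matrix.fromBlocks_smul]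
    simp only [smul_zero]
    rfl

section Seminorms

variable {d : ℕ} {G : Subgroup (Euc d)}

/-- The space of all maps `u : R → ℝ^d`, with the norm `(∑_{g ∈ R} ‖u g‖²)^{1/2}`. -/
abbrev Disp (R : Finset G) : Type := PiLp 2 fun _ : R => Vec d

/-- `U_trans(R)`: there is `a ∈ ℝ^d` with `rot(g) u(g) = a` for all `g ∈ R`. -/
def Utrans (R : Finset G) : Submodule ℝ (Disp R) where
  carrier := {u | ∃ a : Vec d, ∀ g : R, rot (g.1 : Euc d) (u g) = a}
  add_mem' := by
    rintro u v ⟨a, ha⟩ ⟨b, hb⟩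
    exact ⟨a + b, fun g => by simp [ha g, hb g]⟩
  zero_mem' := ⟨0, fun g => by simp⟩
  smul_mem' := by
    rintro c u ⟨a, ha⟩
    exact ⟨c • a, fun g => by simp [ha g]⟩

/-- For a space `W` of matrices: there is `S ∈ W` with `rot(g) u(g) = S (g · x₀ - x₀)` for all
`g ∈ R`. -/
def UrotOf (W : Submodule ℝ (Matrix (Fin d) (Fin d) ℝ)) (x₀ : Vec d) (R : Finset G) :
    Submodule ℝ (Disp R) where
  carrier := {u | ∃ S ∈ W, ∀ g : R,
    rot (g.1 : Euc d) (u g) = Matrix.toEuclideanLin S ((g.1 : Euc d) x₀ - x₀)}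
  add_mem' := by
    rintro u v ⟨a, hW, ha⟩ ⟨b, hW', hb⟩
    exact ⟨a + b, add_mem hW hW', fun g => by
      rw [PiLp.add_apply, map_add, map_add, LinearMap.add_apply, ha g, hb g]⟩
  zero_mem' := ⟨0, zero_mem _, fun g => by
    rw [PiLp.zero_apply, map_zero, map_zero, LinearMap.zero_apply]⟩
  smul_mem' := by
    rintro c u ⟨a, hW, ha⟩
    exact ⟨c • a, Submodule.smul_mem _ c hW, fun g => by
      rw [PiLp.smul_apply, map_smul, map_smul, LinearMap.smul_apply, ha g]⟩

/-- `U_rot(R)`: infinitesimal rotations, generated by `S ∈ Skew(d)`. -/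
def Urot (x₀ : Vec d) (R : Finset G) : Submodule ℝ (Disp R) := UrotOf (skew d) x₀ R

/-- `U_iso(R) = U_trans(R) + U_rot(R)`. -/
def Uiso (x₀ : Vec d) (R : Finset G) : Submodule ℝ (Disp R) := Utrans R ⊔ Urot x₀ R

/-- `U_{rot,0,0}(R)`: infinitesimal rotations about `{0} × ℝ^{d₂}`, generated by `S ⊕ 0` with
`S ∈ Skew(d₁)`. -/
def Urot00 {d₁ d₂ : ℕ} (hd : d₁ + d₂ = d) (x₀ : Vec d) (R : Finset G) : Submodule ℝ (Disp R) :=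
  UrotOf (skewZero hd) x₀ R

/-- `U_{iso,0,0}(R) = U_trans(R) + U_{rot,0,0}(R)`. -/
def Uiso00 {d₁ d₂ : ℕ} (hd : d₁ + d₂ = d) (x₀ : Vec d) (R : Finset G) : Submodule ℝ (Disp R) :=
  Utrans R ⊔ Urot00 hd x₀ R

/-- The orthogonal projection of `{v : R → ℝ^d}` with kernel `U`. -/
def projKer {R : Finset G} (U : Submodule ℝ (Disp R)) (v : Disp R) : Disp R :=
  Uᗮ.starProjection v

/-- The patch `u(g ·)|_R`, i.e. `h ↦ u(g h)`. -/
def patch (R : Finset G) (u : G → Vec d) (g : G) : Disp R :=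
  WithLp.toLp 2 fun h => u (g * h.1)

/-- The discrete derivative `∇_R u (g) : h ↦ u(g h) - rot(h)ᵀ u(g)`. -/
def nabla (R : Finset G) (u : G → Vec d) (g : G) : Disp R :=
  WithLp.toLp 2 fun h => u (g * h.1) - (rot (h.1 : Euc d)).symm (u g)

/-- `‖u‖_R`, computed with a representation set `C` of `G / T^N` for a `T^N`-periodic `u`. -/
def rigidNorm (x₀ : Vec d) (R C : Finset G) (u : G → Vec d) : ℝ :=
  meanNorm C fun g => projKer (Uiso x₀ R) (patch R u g)

/-- `‖u‖_{R,0,0}`, computed with a representation set `C` of `G / T^N` for a `T^N`-periodic `u`. -/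
def rigidNorm00 {d₁ d₂ : ℕ} (hd : d₁ + d₂ = d) (x₀ : Vec d) (R C : Finset G) (u : G → Vec d) : ℝ :=
  meanNorm C fun g => projKer (Uiso00 hd x₀ R) (patch R u g)

/-- `‖∇_R u‖₂`, computed with a representation set `C` of `G / T^N` for a `T^N`-periodic `u`. -/
def gradNorm (R C : Finset G) (u : G → Vec d) : ℝ :=
  meanNorm C (nabla R u)

/-- Property 1 of a finite set `R`: `id ∈ R` and `aff(R · x₀) = aff(G · x₀)`. -/
structure Property1 (x₀ : Vec d) (R : Finset G) : Prop where
  id_mem : 1 ∈ R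
  aff_eq : affineSpan ℝ ((fun g : G => (g : Euc d) x₀) '' (R : Set G)) =
    affineSpan ℝ (Set.range fun g : G => (g : Euc d) x₀)

/-- Property 2 of a finite set `R`: `R' R'' ⊆ R` for some `R'` that contains the identity and
generates `G` and some `R''` with Property 1. -/
def Property2 (x₀ : Vec d) (R : Finset G) : Prop :=
  ∃ (R' : Set G) (R'' : Finset G), 1 ∈ R' ∧ Subgroup.closure R' = ⊤ ∧ Property1 x₀ R'' ∧
    R' * (R'' : Set G) ⊆ (R : Set G)

end Seminorms

end DiscreteKorn

end

/-! Two of the inequalities are pointwise: `Utrans ≤ Uiso00 ≤ Uiso`, and projecting along a larger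
subspace gives a smaller norm, so `rigidNorm ≤ rigidNorm00 ≤ gradNorm`. Everything then follows from
`gradNorm ≤ K * rigidNorm`.

For this, put f(g) = rot(g) u(g) and let e(g) be the norm of the projected patch at g. Up to a
multiple of e(g), the increments f(gh) - f(g), h ∈ R, equal S(g)(gh·x₀ - g·x₀) with S(g) skew
(`exists_skew_approx`). Because R contains R'R'' and R''·x₀ spans, comparing the approximations at g
and gr shows that S varies slowly along r ∈ R' (`dominated_norm_sub`). As R' generates G, the
approximation extends to increments along every w ∈ G, with an error bounded by finitely many right
translates of e (`dominated_residual_of_closure`). In quadratic mean, right translates of e cost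
nothing.

The remaining task is to bound S. For a translation t, tg = g(g⁻¹tg), and g⁻¹tg takes only finitely
many values, so f(tg) - f(g) is close to S(g) applied to the vector of t (`dominated_translate`).
Left multiplications by translations are commuting permutations of the finite quotient G/T^N, so
summation by parts bounds all these differences in ℓ² by their symmetric part
(`sum_sq_difference_le`). Since S is skew, the symmetric part contains only errors. Hence the
differences, then S, then ∇u are bounded by e in ℓ² (`exists_sum_sq_skew_le`,
`exists_sum_sq_nabla_le`), with constants chosen before N, C and u. -/

namespace DiscreteKorn

/-! ### Pointwise bounds by finitely many right translates. -/

section Domination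

variable {ι Γ : Type*} [Group Γ] {e φ ψ : ι → Γ → ℝ}

/-- The function `φ i` is bounded pointwise by a fixed multiple of a sum of finitely many right
translates of `e i`, uniformly in `i`. -/
def Dominated (e φ : ι → Γ → ℝ) : Prop :=
  ∃ K : ℝ, 0 ≤ K ∧ ∃ F : Finset Γ, ∀ i g, φ i g ≤ K * ∑ k ∈ F, e i (g * k)

theorem Dominated.refl (e : ι → Γ → ℝ) : Dominated e e :=
  ⟨1, zero_le_one, {1}, fun i g => by simp⟩

theorem Dominated.zero (e : ι → Γ → ℝ) : Dominated e fun _ _ => 0 :=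
  ⟨0, le_rfl, ∅, fun i g => by simp⟩

theorem Dominated.mono (h : Dominated e ψ) (hle : ∀ i g, φ i g ≤ ψ i g) : Dominated e φ := by
  obtain ⟨K, hK, F, hF⟩ := h
  exact ⟨K, hK, F, fun i g => (hle i g).trans (hF i g)⟩

theorem Dominated.add (he : ∀ i g, 0 ≤ e i g) (h₁ : Dominated e φ) (h₂ : Dominated e ψ) :
    Dominated e fun i g => φ i g + ψ i g := by
  classical
  obtain ⟨K₁, hK₁, F₁, hF₁⟩ := h₁
  obtain ⟨K₂, hK₂, F₂, hF₂⟩ := h₂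
  refine ⟨K₁ + K₂, add_nonneg hK₁ hK₂, F₁ ∪ F₂, fun i g => ?_⟩
  have h₁ : ∑ k ∈ F₁, e i (g * k) ≤ ∑ k ∈ F₁ ∪ F₂, e i (g * k) :=
    Finset.sum_le_sum_of_subset_of_nonneg Finset.subset_union_left fun k _ _ => he _ _
  have h₂ : ∑ k ∈ F₂, e i (g * k) ≤ ∑ k ∈ F₁ ∪ F₂, e i (g * k) :=
    Finset.sum_le_sum_of_subset_of_nonneg Finset.subset_union_right fun k _ _ => he _ _
  rw [add_mul]
  exact add_le_add ((hF₁ i g).trans (mul_le_mul_of_nonneg_left h₁ hK₁))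
    ((hF₂ i g).trans (mul_le_mul_of_nonneg_left h₂ hK₂))

theorem Dominated.const_mul (h : Dominated e φ) {c : ℝ} (hc : 0 ≤ c) :
    Dominated e fun i g => c * φ i g := by
  obtain ⟨K, hK, F, hF⟩ := h
  exact ⟨c * K, mul_nonneg hc hK, F, fun i g => by
    rw [mul_assoc]; exact mul_le_mul_of_nonneg_left (hF i g) hc⟩

theorem Dominated.shift (h : Dominated e φ) (w : Γ) : Dominated e fun i g => φ i (g * w) := by
  classical
  obtain ⟨K, hK, F, hF⟩ := h
  refine ⟨K, hK, F.image (w * ·), fun i g => ?_⟩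
  rw [Finset.sum_image fun a _ b _ hab => mul_left_cancel hab]
  simpa [mul_assoc] using hF i (g * w)

theorem Dominated.sum (he : ∀ i g, 0 ≤ e i g) {κ : Type*} (A : Finset κ)
    {φ : κ → ι → Γ → ℝ} (h : ∀ a ∈ A, Dominated e (φ a)) :
    Dominated e fun i g => ∑ a ∈ A, φ a i g := by
  classical
  induction A using Finset.induction_on with
  | empty => simpa using Dominated.zero e
  | insert a A ha ih =>
    simp only [Finset.sum_insert ha]
    exact (h a (Finset.mem_insert_self a A)).add he
      (ih fun b hb => h b (Finset.mem_insert_of_mem hb))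

end Domination

/-! ### Sums over representatives of a finite quotient. -/

section Transversal

variable {Γ : Type*} [Group Γ]

/-- `C` contains exactly one element of each left coset of `H`. -/
def IsTransversal (H : Subgroup Γ) (C : Finset Γ) : Prop :=
  ∀ g, ∃! c, c ∈ C ∧ ∃ t ∈ H, g = c * t

theorem IsTransversal.bijective {H : Subgroup Γ} {C : Finset Γ} (hC : IsTransversal H C) :
    Function.Bijective fun c : C => (c.1 : Γ ⧸ H) := by
  constructor
  · rintro ⟨a, ha⟩ ⟨b, hb⟩ hab
    have hab' : a⁻¹ * b ∈ H := QuotientGroup.eq.mp hab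
    exact Subtype.ext ((hC b).unique ⟨ha, _, hab', by group⟩ ⟨hb, 1, one_mem H, by simp⟩)
  · intro q
    obtain ⟨g, rfl⟩ := QuotientGroup.mk_surjective q
    obtain ⟨c, ⟨hc, t, ht, rfl⟩, -⟩ := hC g
    refine ⟨⟨c, hc⟩, QuotientGroup.eq.mpr (by simpa using ht)⟩

theorem IsTransversal.finite {H : Subgroup Γ} {C : Finset Γ} (hC : IsTransversal H C) :
    Finite (Γ ⧸ H) :=
  Finite.of_surjective _ hC.bijective.2

theorem IsTransversal.sum_eq {H : Subgroup Γ} [Fintype (Γ ⧸ H)] {C : Finset Γ}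
    (hC : IsTransversal H C) (φ : Γ ⧸ H → ℝ) : ∑ c ∈ C, φ c = ∑ q, φ q := by
  rw [← Finset.sum_coe_sort C fun c => φ (c : Γ ⧸ H)]
  exact hC.bijective.sum_comp φ

/-- As H is normal, right multiplication by w is a permutation of the quotient group, and a periodic
summand does not depend on the choice of representatives. -/
theorem IsTransversal.sum_mul_right {H : Subgroup Γ} [H.Normal] {C : Finset Γ}
    (hC : IsTransversal H C) {φ : Γ → ℝ} (hφ : ∀ g, ∀ t ∈ H, φ (g * t) = φ g) (w : Γ) :
    ∑ c ∈ C, φ (c * w) = ∑ c ∈ C, φ c := by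
  have := hC.finite
  have := Fintype.ofFinite (Γ ⧸ H)
  let ψ : Γ ⧸ H → ℝ := Quotient.lift φ fun a b hab => by
    have := hφ a _ (QuotientGroup.leftRel_apply.mp hab)
    rw [← this]; congr 1; group
  calc ∑ c ∈ C, φ (c * w) = ∑ q : Γ ⧸ H, ψ (q * (w : Γ ⧸ H)) := by
        rw [← hC.sum_eq]; rfl
    _ = ∑ q, ψ q := Equiv.sum_comp (Equiv.mulRight (w : Γ ⧸ H)) ψ
    _ = _ := by rw [← hC.sum_eq]; rfl

/-- Cauchy–Schwarz over the finite set of translates, each of which has the same ℓ² sum. The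
constant depends on the domination alone; this is where uniformity in the period and in the
displacement comes from. -/
theorem Dominated.exists_sum_sq_le {ι : Type*} {e φ : ι → Γ → ℝ}
    (h : Dominated e φ) (hφ : ∀ i g, 0 ≤ φ i g) :
    ∃ K : ℝ, 0 ≤ K ∧ ∀ (H : Subgroup Γ) (_ : H.Normal) (C : Finset Γ) (i : ι),
      IsTransversal H C → (∀ g, ∀ t ∈ H, e i (g * t) = e i g) →
      ∑ c ∈ C, φ i c ^ 2 ≤ K * ∑ c ∈ C, e i c ^ 2 := by
  obtain ⟨K, hK, F, hF⟩ := h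
  refine ⟨K ^ 2 * F.card * F.card, by positivity, fun H _ C i hC hper => ?_⟩
  calc ∑ c ∈ C, φ i c ^ 2 ≤ ∑ c ∈ C, K ^ 2 * (F.card * ∑ k ∈ F, e i (c * k) ^ 2) := by
        refine Finset.sum_le_sum fun c _ => ?_
        calc φ i c ^ 2 ≤ (K * ∑ k ∈ F, e i (c * k)) ^ 2 :=
              pow_le_pow_left₀ (hφ i c) (hF i c) 2
          _ ≤ _ := by
              rw [mul_pow]
              exact mul_le_mul_of_nonneg_left sq_sum_le_card_mul_sum_sq (sq_nonneg K)
    _ = K ^ 2 * F.card * ∑ k ∈ F, ∑ c ∈ C, e i (c * k) ^ 2 := by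
        rw [← Finset.mul_sum, ← Finset.mul_sum, Finset.sum_comm, mul_assoc]
    _ = K ^ 2 * F.card * F.card * ∑ c ∈ C, e i c ^ 2 := by
        rw [Finset.sum_congr rfl fun k _ => hC.sum_mul_right (φ := fun g => e i g ^ 2)
          (fun g t ht => by simp only [hper g t ht]) k]
        simp [mul_assoc]

end Transversal

/-! ### A Korn inequality for commuting permutations. -/

section DiscreteDerivatives

variable {Q ι : Type*} [Fintype Q]

/-- Summation by parts for the forward differences along commuting permutations. -/
theorem sum_difference_mul_difference (τ : ι → Equiv.Perm Q)
    (hτ : ∀ i j q, τ i (τ j q) = τ j (τ i q))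
    (f : ι → Q → ℝ) (i j : ι) :
    ∑ q, (f j (τ i q) - f j q) * (f i (τ j q) - f i q) =
      ∑ q, (f j ((τ j).symm q) - f j q) * (f i ((τ i).symm q) - f i q) := by
  -- Substituting q ↦ τ_j τ_i q turns both backward shifts into forward ones; only here is
  -- commutativity needed.
  have h₁ : ∑ q, f j ((τ j).symm q) * f i ((τ i).symm q) = ∑ q, f j (τ i q) * f i (τ j q) := by
    rw [← Equiv.sum_comp ((τ i).trans (τ j))]
    refine Finset.sum_congr rfl fun q _ => ?_
    simp only [Equiv.trans_apply, Equiv.symm_apply_apply]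
    rw [← hτ i j, Equiv.symm_apply_apply]
  have h₂ : ∑ q, f j ((τ j).symm q) * f i q = ∑ q, f j q * f i (τ j q) := by
    rw [← Equiv.sum_comp (τ j)]; simp
  have h₃ : ∑ q, f j q * f i ((τ i).symm q) = ∑ q, f j (τ i q) * f i q := by
    rw [← Equiv.sum_comp (τ i)]; simp
  simp only [sub_mul, mul_sub, Finset.sum_sub_distrib]
  rw [h₁, h₂, h₃]
  ring

/-- A discrete Korn inequality: forward differences along commuting permutations are controlled in
`ℓ²` by their symmetric part. -/
theorem sum_sq_difference_le [Fintype ι] (τ : ι → Equiv.Perm Q)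
    (hτ : ∀ i j q, τ i (τ j q) = τ j (τ i q))
    (f : ι → Q → ℝ) :
    ∑ i, ∑ j, ∑ q, (f j (τ i q) - f j q) ^ 2 ≤
      ∑ i, ∑ j, ∑ q, ((f j (τ i q) - f j q) + (f i (τ j q) - f i q)) ^ 2 := by
  -- After summation by parts the cross terms add up to the sum of squares of the backward
  -- divergence.
  have hcross : 0 ≤ ∑ i, ∑ j, ∑ q, (f j (τ i q) - f j q) * (f i (τ j q) - f i q) := by
    have : ∑ i, ∑ j, ∑ q, (f j (τ i q) - f j q) * (f i (τ j q) - f i q) =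
        ∑ q, (∑ i, (f i ((τ i).symm q) - f i q)) ^ 2 := by
      simp only [sum_difference_mul_difference τ hτ f, sq, Finset.sum_mul_sum]
      symm
      rw [Finset.sum_comm]
      refine Finset.sum_congr rfl fun i _ => ?_
      rw [Finset.sum_comm]
      exact Finset.sum_congr rfl fun j _ => Finset.sum_congr rfl fun q _ => mul_comm _ _
    rw [this]
    exact Finset.sum_nonneg fun q _ => sq_nonneg _
  have hswap : ∑ i, ∑ j, ∑ q, (f i (τ j q) - f i q) ^ 2 =
      ∑ i, ∑ j, ∑ q, (f j (τ i q) - f j q) ^ 2 := Finset.sum_comm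
  have hnonneg : 0 ≤ ∑ i, ∑ j, ∑ q, (f j (τ i q) - f j q) ^ 2 :=
    Finset.sum_nonneg fun i _ => Finset.sum_nonneg fun j _ => Finset.sum_nonneg fun q _ =>
      sq_nonneg _
  have hexp : ∑ i, ∑ j, ∑ q, ((f j (τ i q) - f j q) + (f i (τ j q) - f i q)) ^ 2 =
      ∑ i, ∑ j, ∑ q, (f j (τ i q) - f j q) ^ 2 +
        2 * ∑ i, ∑ j, ∑ q, (f j (τ i q) - f j q) * (f i (τ j q) - f i q) +
        ∑ i, ∑ j, ∑ q, (f i (τ j q) - f i q) ^ 2 := by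
    simp only [add_sq, Finset.sum_add_distrib, Finset.mul_sum, mul_assoc]
  rw [hexp, hswap]
  linarith

end DiscreteDerivatives

/-! ### Operator norms from values on a spanning family. -/

section Spanning

variable {V W κ : Type*} [NormedAddCommGroup V] [NormedSpace ℝ V] [FiniteDimensional ℝ V]
  [NormedAddCommGroup W] [NormedSpace ℝ W] [FiniteDimensional ℝ W] [Fintype κ]

/-- The norm of a linear map is controlled by its values on a spanning family. -/
theorem exists_opNorm_le_of_span_eq_top (v : κ → V) (hv : Submodule.span ℝ (Set.range v) = ⊤) :
    ∃ K : ℝ, 0 ≤ K ∧ ∀ A : V →L[ℝ] W, ‖A‖ ≤ K * ∑ k, ‖A (v k)‖ := by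
  let E : (V →L[ℝ] W) →ₗ[ℝ] (κ → W) :=
    { toFun := fun A k => A (v k)
      map_add' := fun _ _ => rfl
      map_smul' := fun _ _ => rfl }
  -- An injective linear map on a finite-dimensional space is bounded below.
  have hE : LinearMap.ker E = ⊥ := by
    rw [LinearMap.ker_eq_bot']
    intro A hA
    have : (A : V →ₗ[ℝ] W) = 0 := LinearMap.ext_on_range hv fun k => congrFun hA k
    ext x
    exact congrArg (fun B : V →ₗ[ℝ] W => B x) this
  obtain ⟨K, -, hK⟩ := E.exists_antilipschitzWith hE
  refine ⟨K, K.2, fun A => ?_⟩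
  have h := hK.le_mul_dist A 0
  rw [map_zero, dist_zero_right, dist_zero_right] at h
  refine h.trans (mul_le_mul_of_nonneg_left ?_ K.2)
  refine (pi_norm_le_iff_of_nonneg (Finset.sum_nonneg fun k _ => norm_nonneg _)).mpr fun k => ?_
  exact Finset.single_le_sum (f := fun k => ‖A (v k)‖) (fun k _ => norm_nonneg _)
    (Finset.mem_univ k)

end Spanning

open scoped RealInnerProductSpace

/-! ### Translations in the Euclidean group. -/

section Isometries

variable {d : ℕ}

@[simp] theorem rot_mul_apply (g h : Euc d) (x : Vec d) : rot (g * h) x = rot g (rot h x) := rfl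

theorem apply_sub_apply (g : Euc d) (x y : Vec d) : g x - g y = rot g (x - y) :=
  (g.map_vsub x y).symm

theorem rot_inv_apply (g : Euc d) (x : Vec d) : rot g⁻¹ x = (rot g).symm x := rfl

theorem IsTranslation.apply {g : Euc d} (hg : IsTranslation g) (x : Vec d) :
    g x = x + transl g := by
  have h := apply_sub_apply g x 0
  rw [hg] at h
  simpa [transl, sub_eq_iff_eq_add] using h

theorem isTranslation_of_forall {g : Euc d} {b : Vec d} (h : ∀ x, g x = x + b) :
    IsTranslation g := by
  refine LinearIsometryEquiv.ext fun x => ?_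
  have := apply_sub_apply g x 0
  rw [h, h] at this
  simpa using this.symm

theorem IsTranslation.commute {g h : Euc d} (hg : IsTranslation g) (hh : IsTranslation h) :
    g * h = h * g := by
  ext1 x
  change g (h x) = h (g x)
  rw [hg.apply, hh.apply, hh.apply, hg.apply, add_right_comm]

theorem IsTranslation.pow {t : Euc d} (ht : IsTranslation t) (n : ℕ) : IsTranslation (t ^ n) := by
  induction n with
  | zero => rfl
  | succ n ih =>
    refine LinearIsometryEquiv.ext fun x => ?_
    rw [pow_succ, rot_mul_apply, ih, ht]
    rfl

theorem IsTranslation.conj {t : Euc d} (ht : IsTranslation t) (g : Euc d) :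
    IsTranslation (g⁻¹ * t * g) := by
  refine LinearIsometryEquiv.ext fun x => ?_
  rw [rot_mul_apply, rot_mul_apply, ht, rot_inv_apply]
  simp

end Isometries

/-! ### A space group in normal form has d₁ = 0. -/

section NormalForm

variable {d d₁ d₂ : ℕ} (hd : d₁ + d₂ = d)

theorem matrixSum_zero_mem_skew {A : Matrix (Fin d₁) (Fin d₁) ℝ} (hA : A ∈ skew d₁) :
    matrixSum hd A (0 : Matrix (Fin d₂) (Fin d₂) ℝ) ∈ skew d := by
  have hA' : A.transpose = -A := hA
  change (matrixSum hd A 0).transpose = -matrixSum hd A 0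
  rw [matrixSum, Matrix.transpose_reindex, Matrix.fromBlocks_transpose, hA']
  ext i j
  simp only [Matrix.reindex_apply, Matrix.submatrix_apply, Matrix.neg_apply]
  rcases (finSumFinEquiv.trans (finCongr hd)).symm i with a | a <;>
    rcases (finSumFinEquiv.trans (finCongr hd)).symm j with b | b <;> simp

theorem skewZero_le_skew : skewZero hd ≤ skew d := by
  rintro _ ⟨S, hS, rfl⟩
  exact matrixSum_zero_mem_skew hd hS

theorem blockVec_castAdd (x : Vec d₁) (y : Vec d₂) (i : Fin d₁) :
    blockVec hd x y (Fin.cast hd (Fin.castAdd d₂ i)) = x i := by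
  simp [blockVec]

theorem exists_blockVec (z : Vec d) : ∃ x y, blockVec hd x y = z := by
  subst hd
  refine ⟨WithLp.toLp 2 fun i => z (Fin.castAdd d₂ i),
    WithLp.toLp 2 fun i => z (Fin.natAdd d₁ i), ?_⟩
  ext i
  refine Fin.addCases (fun i => ?_) (fun i => ?_) i <;> simp [blockVec]

theorem blockVec_add (x x' : Vec d₁) (y y' : Vec d₂) :
    blockVec hd (x + x') (y + y') = blockVec hd x y + blockVec hd x' y' := by
  subst hd
  ext i
  refine Fin.addCases (fun i => ?_) (fun i => ?_) i <;> simp [blockVec]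

/-- In a splitting of `ℝ^d` preserved by a space group of `ℝ^d` that acts linearly on the first
factor, the first factor is trivial. -/
theorem IsNormalForm.eq_zero {G : Subgroup (Euc d)} {S : Subgroup (Euc d₂)}
    (hGS : IsNormalForm hd G S) (hG : IsSpaceGroup G) : d₁ = 0 := by
  obtain ⟨t, ht, hlin⟩ := hG.translations
  by_contra hne
  have hspan := hlin.span_eq_top_of_card_eq_finrank' (by simp)
  let i₀ : Fin d₁ := ⟨0, Nat.pos_of_ne_zero hne⟩
  let k : Fin d := Fin.cast hd (Fin.castAdd d₂ i₀)
  -- The first block of g·0 is A0 = 0, so no translation vector has a component there, although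
  -- these vectors span.
  have hzero : ∀ i, transl (t i) k = 0 := by
    intro i
    obtain ⟨s, -, A, hA⟩ := hGS.mapsTo _ (ht i).1
    have h := hA 0 0
    have h0 : blockVec hd (0 : Vec d₁) (0 : Vec d₂) = 0 := by
      simpa using blockVec_add hd 0 0 0 0
    rw [h0, A.map_zero] at h
    rw [transl, h, blockVec_castAdd]
    rfl
  have hle : Submodule.span ℝ (Set.range fun i => transl (t i)) ≤
      LinearMap.ker (EuclideanSpace.proj k : Vec d →L[ℝ] ℝ).toLinearMap := by
    rw [Submodule.span_le]
    rintro _ ⟨i, rfl⟩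
    exact hzero i
  rw [hspan] at hle
  have := hle (Submodule.mem_top (x := EuclideanSpace.single k (1 : ℝ)))
  simp at this

theorem IsTranslationSection.isTranslation {G : Subgroup (Euc d)} {S : Subgroup (Euc d₂)}
    {T : Set G} (hT : IsTranslationSection hd G S T) (hd₁ : d₁ = 0) {t : G} (ht : t ∈ T) :
    IsTranslation (t : Euc d) := by
  subst hd₁
  obtain ⟨s, -, hs, A, hA⟩ := hT.mapsTo t ht
  refine isTranslation_of_forall (b := blockVec hd 0 (transl s)) fun z => ?_
  obtain ⟨x, y, rfl⟩ := exists_blockVec hd z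
  rw [hA, hs.apply, ← blockVec_add, Subsingleton.elim (A x) (x + 0)]

end NormalForm

/-! ### Projected patches and local infinitesimal rotations. -/

section Patches

variable {d : ℕ} {G : Subgroup (Euc d)}

theorem Property2.one_mem {x₀ : Vec d} {R : Finset G} (hR : Property2 x₀ R) : 1 ∈ R := by
  obtain ⟨R', R'', h1, -, hP, hsub⟩ := hR
  exact hsub ⟨1, h1, 1, hP.id_mem, one_mul 1⟩

/-- A finite set with Property 1 spans the linear hull of the translations in the group. -/
theorem Property1.span_eq_top {x₀ : Vec d} {R : Finset G} (hR : Property1 x₀ R)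
    (hG : IsSpaceGroup G) :
    Submodule.span ℝ (Set.range fun h : R => (h.1 : Euc d) x₀ - x₀) = ⊤ := by
  obtain ⟨t, ht, hlin⟩ := hG.translations
  have hmem : x₀ ∈ (fun g : G => (g : Euc d) x₀) '' (R : Set G) := ⟨1, hR.id_mem, rfl⟩
  have hvec : vectorSpan ℝ ((fun g : G => (g : Euc d) x₀) '' (R : Set G)) = ⊤ := by
    rw [← direction_affineSpan, hR.aff_eq, direction_affineSpan, eq_top_iff,
      ← hlin.span_eq_top_of_card_eq_finrank' (by simp), Submodule.span_le]
    rintro _ ⟨i, rfl⟩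
    have : transl (t i) = (t i) x₀ -ᵥ x₀ := by rw [(ht i).2.apply]; simp
    simp only [this, SetLike.mem_coe]
    exact vsub_mem_vectorSpan ℝ ⟨⟨t i, (ht i).1⟩, rfl⟩ ⟨1, rfl⟩
  rw [vectorSpan_eq_span_vsub_set_right ℝ hmem] at hvec
  rw [eq_top_iff, ← hvec]
  refine Submodule.span_mono ?_
  rintro _ ⟨_, ⟨g, hg, rfl⟩, rfl⟩
  exact ⟨⟨g, hg⟩, rfl⟩

/-- The displacement `u`, with values transported to the fixed frame. -/
noncomputable def labField (u : G → Vec d) (g : G) : Vec d := rot (g : Euc d) (u g)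

theorem norm_nabla_apply (R : Finset G) (u : G → Vec d) (g : G) (h : R) :
    ‖nabla R u g h‖ = ‖labField u (g * h.1) - labField u g‖ := by
  have : labField u (g * h.1) - labField u g =
      rot ((g : Euc d) * (h.1 : Euc d)) (nabla R u g h) := by
    change _ = rot ((g : Euc d) * (h.1 : Euc d))
      (u (g * h.1) - (rot (h.1 : Euc d)).symm (u g))
    rw [map_sub, rot_mul_apply _ _ ((rot (h.1 : Euc d)).symm (u g)),
      LinearIsometryEquiv.apply_symm_apply]
    rfl
  rw [this, LinearIsometryEquiv.norm_map]

theorem norm_projKer_le_norm_sub {R : Finset G} {U : Submodule ℝ (Disp R)} (v : Disp R)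
    {w : Disp R} (hw : w ∈ U) : ‖projKer U v‖ ≤ ‖v - w‖ := by
  have : projKer U v = projKer U (v - w) := by
    have h0 : Uᗮ.starProjection w = 0 := by
      rw [Submodule.starProjection_apply_eq_zero_iff]
      exact Submodule.le_orthogonal_orthogonal U hw
    simp [projKer, map_sub, h0]
  rw [this]
  exact Submodule.norm_starProjection_apply_le _ _

theorem sub_projKer_mem {R : Finset G} (U : Submodule ℝ (Disp R)) (v : Disp R) :
    v - projKer U v ∈ U := by
  have h := Submodule.sub_starProjection_mem_orthogonal (K := Uᗮ) v
  rwa [Submodule.orthogonal_orthogonal] at h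

theorem norm_projKer_le_of_le {R : Finset G} {U W : Submodule ℝ (Disp R)} (h : U ≤ W)
    (v : Disp R) : ‖projKer W v‖ ≤ ‖projKer U v‖ := by
  simpa using norm_projKer_le_norm_sub v (h (sub_projKer_mem U v))

/-- The discrete derivative is the patch minus the element of `Utrans` generated by the constant a =
u(g). -/
theorem norm_projKer_patch_le_norm_nabla {R : Finset G} {U : Submodule ℝ (Disp R)}
    (hU : Utrans R ≤ U) (u : G → Vec d) (g : G) :
    ‖projKer U (patch R u g)‖ ≤ ‖nabla R u g‖ := by
  let w : Disp R := WithLp.toLp 2 fun h => (rot (h.1 : Euc d)).symm (u g)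
  have hw : w ∈ Utrans R := ⟨u g, fun h => (rot (h.1 : Euc d)).apply_symm_apply (u g)⟩
  have hsub : nabla R u g = patch R u g - w := by
    rw [nabla, patch, ← WithLp.toLp_sub]
    rfl
  rw [hsub]
  exact norm_projKer_le_norm_sub _ (hU hw)

theorem inner_toEuclideanLin_add {A : Matrix (Fin d) (Fin d) ℝ} (hA : A ∈ skew d) (x y : Vec d) :
    ⟪Matrix.toEuclideanLin A x, y⟫ + ⟪x, Matrix.toEuclideanLin A y⟫ = 0 := by
  have hA' : A.transpose = -A := hA
  have h : Matrix.toEuclideanLin A y = -(Matrix.toEuclideanLin A.conjTranspose y) := by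
    rw [Matrix.conjTranspose_eq_transpose_of_trivial, hA', map_neg]; simp
  rw [h, inner_neg_right, Matrix.toEuclideanLin_conjTranspose_eq_adjoint,
    LinearMap.adjoint_inner_right, add_neg_cancel]

/-- Near each `g`, the displacement is an infinitesimal rotation up to an error controlled by the
projected patch. -/
theorem exists_skew_approx (x₀ : Vec d) {R : Finset G} (h1 : 1 ∈ R) (u : G → Vec d) (g : G) :
    ∃ s : Vec d →L[ℝ] Vec d, (∀ x y, ⟪s x, y⟫ + ⟪x, s y⟫ = 0) ∧ ∀ h ∈ R,
      ‖labField u (g * h) - labField u g -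
        s (((g * h : G) : Euc d) x₀ - (g : Euc d) x₀)‖ ≤
        2 * ‖projKer (Uiso x₀ R) (patch R u g)‖ := by
  set p := projKer (Uiso x₀ R) (patch R u g) with hp
  obtain ⟨v, ⟨a, ha⟩, w, ⟨A, hA, hw⟩, hvw⟩ :=
    Submodule.mem_sup.mp (sub_projKer_mem (Uiso x₀ R) (patch R u g))
  let Q := rot (g : Euc d)
  let s₀ : Vec d →ₗ[ℝ] Vec d := Matrix.toEuclideanLin A
  -- Conjugation by rot(g) carries the skew map of the patch to the fixed frame and keeps it skew.
  let s : Vec d →ₗ[ℝ] Vec d := Q.toLinearEquiv.toLinearMap ∘ₗ s₀ ∘ₗ Q.symm.toLinearEquiv.toLinearMap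
  have hs : ∀ x, s x = Q (s₀ (Q.symm x)) := fun _ => rfl
  refine ⟨LinearMap.toContinuousLinearMap s, fun x y => ?_, fun h hh => ?_⟩
  · have := inner_toEuclideanLin_add hA (Q.symm x) (Q.symm y)
    rw [← Q.inner_map_map, ← Q.inner_map_map (Q.symm x), Q.apply_symm_apply, Q.apply_symm_apply]
      at this
    exact this
  · have key : ∀ h : R, labField u (g * h.1) =
        Q (a + s₀ ((h.1 : Euc d) x₀ - x₀)) + Q (rot (h.1 : Euc d) (p h)) := by
      intro h
      have h1 : u (g * h.1) = v h + w h + p h := by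
        have := congrArg (fun z : Disp R => z h) hvw
        have h2 : v h + w h = u (g * h.1) - p h := this
        rw [h2, sub_add_cancel]
      change Q (rot (h.1 : Euc d) (u (g * h.1))) = _
      rw [h1, map_add (rot (h.1 : Euc d)), map_add (rot (h.1 : Euc d)), ha, hw, map_add Q]
    have k1 := key ⟨h, hh⟩
    have k2 := key ⟨1, h1⟩
    simp only [mul_one] at k2
    have hx : ((g * h : G) : Euc d) x₀ - (g : Euc d) x₀ = Q ((h : Euc d) x₀ - x₀) :=
      apply_sub_apply (g : Euc d) ((h : Euc d) x₀) x₀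
    have hone : ((1 : G) : Euc d) x₀ - x₀ = 0 := sub_self x₀
    -- Subtracting the formula at the identity removes the unknown translation a. Two values of the
    -- projected patch remain, whence the factor 2.
    have hrw : labField u (g * h) - labField u g -
        LinearMap.toContinuousLinearMap s (((g * h : G) : Euc d) x₀ - (g : Euc d) x₀) =
        Q (rot (h : Euc d) (p ⟨h, hh⟩)) - Q (rot ((1 : G) : Euc d) (p ⟨1, h1⟩)) := by
      rw [k1, k2, hx, LinearMap.coe_toContinuousLinearMap', hs, Q.symm_apply_apply, hone,
        map_zero, add_zero, map_add]
      abel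
    rw [hrw]
    refine (norm_sub_le _ _).trans ?_
    simp only [LinearIsometryEquiv.norm_map]
    have := PiLp.norm_apply_le p ⟨h, hh⟩
    have := PiLp.norm_apply_le p ⟨1, h1⟩
    linarith

end Patches

/-! ### From increments along R to increments along all of G. -/

section Propagation

variable {d : ℕ} {G : Subgroup (Euc d)} {ι : Type*}

/-- The deviation of the increment of `f` along `w` from the linear map `S`. -/
noncomputable def residual (x₀ : Vec d) (f : ι → G → Vec d) (S : ι → G → Vec d →L[ℝ] Vec d)
    (w : G) (i : ι) (g : G) : ℝ :=
  ‖f i (g * w) - f i g - S i g (((g * w : G) : Euc d) x₀ - (g : Euc d) x₀)‖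

theorem apply_mul_sub (x₀ : Vec d) (g w : G) :
    ((g * w : G) : Euc d) x₀ - (g : Euc d) x₀ = rot (g : Euc d) ((w : Euc d) x₀ - x₀) :=
  apply_sub_apply (g : Euc d) ((w : Euc d) x₀) x₀

theorem norm_apply_mul_sub (x₀ : Vec d) (g w : G) :
    ‖((g * w : G) : Euc d) x₀ - (g : Euc d) x₀‖ = ‖(w : Euc d) x₀ - x₀‖ := by
  rw [apply_mul_sub, LinearIsometryEquiv.norm_map]

variable {x₀ : Vec d} {e : ι → G → ℝ} {f : ι → G → Vec d} {S : ι → G → Vec d →L[ℝ] Vec d}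

/-- Split the increment at gv; the last term is the price of replacing S(gv) by S(g). -/
theorem residual_mul_le (v w : G) (i : ι) (g : G) :
    residual x₀ f S (v * w) i g ≤ residual x₀ f S w i (g * v) + residual x₀ f S v i g +
      ‖(w : Euc d) x₀ - x₀‖ * ‖S i (g * v) - S i g‖ := by
  have h := (S i (g * v) - S i g).le_opNorm
    (((g * v * w : G) : Euc d) x₀ - ((g * v : G) : Euc d) x₀)
  rw [norm_apply_mul_sub, mul_comm] at h
  refine le_trans ?_ (add_le_add_right h _)
  refine le_trans (le_of_eq ?_) norm_add₃_le
  rw [residual, ← mul_assoc]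
  congr 1
  simp only [map_sub, _root_.sub_apply]
  abel

/-- The increment along w⁻¹ at g is minus the increment along w at gw⁻¹; again the base point of S
has to be moved. -/
theorem residual_inv_le (w : G) (i : ι) (g : G) :
    residual x₀ f S w⁻¹ i g ≤ residual x₀ f S w i (g * w⁻¹) +
      ‖((w⁻¹ : G) : Euc d) x₀ - x₀‖ * ‖S i (g * w⁻¹ * w) - S i (g * w⁻¹)‖ := by
  have h := (S i (g * w⁻¹ * w) - S i (g * w⁻¹)).le_opNorm
    (((g * w⁻¹ : G) : Euc d) x₀ - (g : Euc d) x₀)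
  rw [norm_apply_mul_sub, mul_comm] at h
  refine le_trans ?_ (add_le_add_right h _)
  rw [residual, residual, ← norm_neg (f i (g * w⁻¹ * w) - _ - _), inv_mul_cancel_right]
  rw [← norm_neg ((S i g - S i (g * w⁻¹)) _)]
  refine le_trans (le_of_eq ?_) (norm_add_le _ _)
  congr 1
  simp only [map_sub, _root_.sub_apply]
  abel

/-- If the increments of `f` along a set `R ⊇ R' R''` are approximately given by `S`, then `S`
varies slowly along `R'`. -/
theorem dominated_norm_sub (he : ∀ i g, 0 ≤ e i g) {R'' : Finset G} {r : G}
    (hspan : Submodule.span ℝ (Set.range fun h : R'' => (h.1 : Euc d) x₀ - x₀) = ⊤)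
    (hr : Dominated e (residual x₀ f S r)) (h₁ : ∀ h ∈ R'', Dominated e (residual x₀ f S h))
    (h₂ : ∀ h ∈ R'', Dominated e (residual x₀ f S (r * h))) :
    Dominated e fun i g => ‖S i (g * r) - S i g‖ := by
  obtain ⟨K, hK, hKA⟩ := exists_opNorm_le_of_span_eq_top (W := Vec d) _ hspan
  have hdom : Dominated e fun i g => K * ∑ h : R'', (residual x₀ f S (r * h.1) i g +
      residual x₀ f S r i g + residual x₀ f S h.1 i (g * r)) :=
    (Dominated.sum he Finset.univ fun h _ => ((h₂ h.1 h.2).add he hr).add he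
      ((h₁ h.1 h.2).shift r)).const_mul hK
  refine hdom.mono fun i g => ?_
  -- Precomposing with rot(gr) keeps the norm and turns the fixed spanning vectors h·x₀ - x₀ into
  -- the actual increments grh·x₀ - gr·x₀, so the constant does not depend on g.
  rw [← ContinuousLinearMap.opNorm_comp_linearIsometryEquiv _ (rot ((g * r : G) : Euc d))]
  refine (hKA _).trans (mul_le_mul_of_nonneg_left (Finset.sum_le_sum fun h _ => ?_) hK)
  have hrot : rot ((g * r : G) : Euc d) ((h.1 : Euc d) x₀ - x₀) =
      ((g * r * h.1 : G) : Euc d) x₀ - ((g * r : G) : Euc d) x₀ := (apply_mul_sub x₀ _ _).symm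
  change ‖(S i (g * r) - S i g) (rot ((g * r : G) : Euc d) ((h.1 : Euc d) x₀ - x₀))‖ ≤ _
  rw [hrot, residual, residual, residual, ← mul_assoc,
    ← norm_neg (f i (g * r) - _ - _), ← norm_neg (f i (g * r * h.1) - f i (g * r) - _)]
  refine le_trans (le_of_eq ?_) norm_add₃_le
  congr 1
  simp only [map_sub, _root_.sub_apply]
  abel

/-- The induction must carry the residual and the variation of S together, since the former for
products and inverses uses the latter. -/
theorem dominated_residual_of_closure (he : ∀ i g, 0 ≤ e i g) {R' : Set G}
    (hR' : Subgroup.closure R' = ⊤) (h₁ : ∀ r ∈ R', Dominated e (residual x₀ f S r))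
    (h₂ : ∀ r ∈ R', Dominated e fun i g => ‖S i (g * r) - S i g‖) (w : G) :
    Dominated e (residual x₀ f S w) := by
  suffices h : Dominated e (residual x₀ f S w) ∧ Dominated e fun i g => ‖S i (g * w) - S i g‖ from
    h.1
  have hw : w ∈ Subgroup.closure R' := hR' ▸ Subgroup.mem_top w
  induction hw using Subgroup.closure_induction with
  | mem r hr => exact ⟨h₁ r hr, h₂ r hr⟩
  | one =>
    constructor <;> refine (Dominated.zero e).mono fun i g => le_of_eq ?_ <;> simp [residual]
  | mul v w _ _ hv hw =>
    refine ⟨(((hw.1.shift v).add he hv.1).add he (hv.2.const_mul (norm_nonneg _))).mono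
      fun i g => residual_mul_le v w i g, ((hw.2.shift v).add he hv.2).mono fun i g => ?_⟩
    simp only [← mul_assoc]
    exact norm_sub_le_norm_sub_add_norm_sub _ _ _
  | inv w _ hw =>
    refine ⟨((hw.1.shift w⁻¹).add he ((hw.2.shift w⁻¹).const_mul (norm_nonneg _))).mono
      fun i g => residual_inv_le w i g, (hw.2.shift w⁻¹).mono fun i g => ?_⟩
    rw [inv_mul_cancel_right, norm_sub_rev]

/-- The increments of `f` under left multiplication by a translation take only finitely many
shapes. -/
theorem dominated_translate (he : ∀ i g, 0 ≤ e i g) (hw : ∀ w, Dominated e (residual x₀ f S w))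
    {H : Subgroup G} (hH : ∀ t ∈ H, IsTranslation (t : Euc d)) {C : Finset G}
    (hC : IsTransversal H C) {t : G} (ht : IsTranslation (t : Euc d)) :
    Dominated e fun i g => ‖f i (t * g) - f i g - S i g (transl (t : Euc d))‖ := by
  -- For g = cs with s a translation, g⁻¹tg = c⁻¹tc because translations commute. Thus finitely many
  -- w suffice.
  refine (Dominated.sum he C fun c _ => hw (c⁻¹ * t * c)).mono fun i g => ?_
  obtain ⟨c, ⟨hc, s, hs, rfl⟩, -⟩ := hC g
  have hcomm : s * (c⁻¹ * t * c) = c⁻¹ * t * c * s :=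
    Subtype.ext (IsTranslation.commute (hH s hs) (ht.conj (c : Euc d)))
  have heq : c * s * (c⁻¹ * t * c) = t * (c * s) := by
    rw [mul_assoc, hcomm]; group
  refine le_trans (le_of_eq ?_) (Finset.single_le_sum
    (f := fun c' => residual x₀ f S (c'⁻¹ * t * c') i (c * s)) (fun _ _ => norm_nonneg _) hc)
  have htr : ((t * (c * s) : G) : Euc d) x₀ - ((c * s : G) : Euc d) x₀ = transl (t : Euc d) := by
    change (t : Euc d) (((c * s : G) : Euc d) x₀) - _ = _
    rw [ht.apply, add_sub_cancel_left]
  simp only [residual, heq, htr]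

end Propagation

/-! ### The Korn inequality on the quotient. -/

section Summation

variable {Γ : Type*} [Group Γ] {V : Type*} [NormedAddCommGroup V] [InnerProductSpace ℝ V]

/-- Left multiplication acts on left cosets, so commuting elements give commuting permutations of
the quotient. -/
theorem IsTransversal.sum_sq_difference_le {κ : Type*} [Fintype κ] {H : Subgroup Γ} {C : Finset Γ}
    (hC : IsTransversal H C) {f : Γ → V} (hf : ∀ g, ∀ t ∈ H, f (g * t) = f g) (t : κ → Γ)
    (ht : ∀ i j, t i * t j = t j * t i) (b : κ → V) :
    ∑ i, ∑ j, ∑ c ∈ C, ⟪f (t i * c) - f c, b j⟫ ^ 2 ≤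
      ∑ i, ∑ j, ∑ c ∈ C, (⟪f (t i * c) - f c, b j⟫ + ⟪f (t j * c) - f c, b i⟫) ^ 2 := by
  have := hC.finite
  have := Fintype.ofFinite (Γ ⧸ H)
  let F : Γ ⧸ H → V := Quotient.lift f fun a b hab => by
    have := hf a _ (QuotientGroup.leftRel_apply.mp hab)
    rw [← this]; congr 1; group
  have h := DiscreteKorn.sum_sq_difference_le
    (fun i => (MulAction.toPerm (t i) : Equiv.Perm (Γ ⧸ H)))
    (fun i j q => by simp only [MulAction.toPerm_apply, smul_smul, ht i j])
    (fun j q => ⟪F q, b j⟫)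
  simp only [← hC.sum_eq] at h
  simp only [inner_sub_left]
  exact h

end Summation

/-! ### The Korn inequality for a space group. -/

section Korn

variable {d : ℕ} {G : Subgroup (Euc d)} {ι : Type*} {x₀ : Vec d} {e : ι → G → ℝ}
  {f : ι → G → Vec d} {S : ι → G → Vec d →L[ℝ] Vec d}

/-- If the differences of `f` along the translations of a space group are approximately given by
the skew maps `S`, then `S` is small in quadratic mean. -/
theorem exists_sum_sq_skew_le (he : ∀ i g, 0 ≤ e i g)
    (hS : ∀ i g x y, ⟪S i g x, y⟫ + ⟪x, S i g y⟫ = 0) (t : Fin d → G)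
    (ht : ∀ k, IsTranslation (t k : Euc d))
    (hlin : LinearIndependent ℝ fun k => transl (t k : Euc d))
    (hdom : ∀ k, Dominated e fun i g =>
      ‖f i (t k * g) - f i g - S i g (transl (t k : Euc d))‖) :
    ∃ K : ℝ, 0 ≤ K ∧ ∀ (H : Subgroup G) (_ : H.Normal) (C : Finset G) (i : ι),
      IsTransversal H C → (∀ g, ∀ s ∈ H, e i (g * s) = e i g) →
      (∀ g, ∀ s ∈ H, f i (g * s) = f i g) →
      ∑ c ∈ C, ‖S i c‖ ^ 2 ≤ K * ∑ c ∈ C, e i c ^ 2 := by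
  set b : Fin d → Vec d := fun k => transl (t k : Euc d) with hb
  have hspan : Submodule.span ℝ (Set.range b) = ⊤ :=
    hlin.span_eq_top_of_card_eq_finrank' (by simp)
  set φ : ι → G → ℝ := fun i g => ∑ k, ‖f i (t k * g) - f i g - S i g (b k)‖ with hφ
  have hφ0 : ∀ i g, 0 ≤ φ i g := fun i g => Finset.sum_nonneg fun k _ => norm_nonneg _
  have hφle : ∀ i g k, ‖f i (t k * g) - f i g - S i g (b k)‖ ≤ φ i g := fun i g k =>
    Finset.single_le_sum (f := fun k => ‖f i (t k * g) - f i g - S i g (b k)‖)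
      (fun k _ => norm_nonneg _) (Finset.mem_univ k)
  obtain ⟨K₁, hK₁, hsum⟩ :=
    (Dominated.sum he Finset.univ fun k _ => hdom k).exists_sum_sq_le hφ0
  obtain ⟨K₂, hK₂, hop⟩ := exists_opNorm_le_of_span_eq_top (W := Vec d) b hspan
  obtain ⟨K₃, hK₃, hinner⟩ := exists_opNorm_le_of_span_eq_top (W := ℝ) b hspan
  set B : ℝ := ∑ k, ‖b k‖ with hB
  have hBle : ∀ k, ‖b k‖ ≤ B := fun k =>
    Finset.single_le_sum (f := fun k => ‖b k‖) (fun k _ => norm_nonneg _) (Finset.mem_univ k)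
  have hcomm : ∀ k l, t k * t l = t l * t k := fun k l =>
    Subtype.ext (IsTranslation.commute (ht k) (ht l))
  refine ⟨2 * K₂ ^ 2 * (K₃ ^ 2 * d * d * (d * d * (2 * B) ^ 2) + 1) * K₁, by positivity,
    fun H hN C i hC hper hfper => ?_⟩
  set D : Fin d → G → Vec d := fun k g => f i (t k * g) - f i g with hD
  -- By skewness the contributions of S cancel in the symmetric part, leaving only the errors
  -- collected in φ.
  have hsym : ∀ k l g, |⟪D k g, b l⟫ + ⟪D l g, b k⟫| ≤ 2 * B * φ i g := by
    intro k l g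
    have hskew := hS i g (b k) (b l)
    rw [real_inner_comm (S i g (b l)) (b k)] at hskew
    have heq : ⟪D k g, b l⟫ + ⟪D l g, b k⟫ =
        ⟪D k g - S i g (b k), b l⟫ + ⟪D l g - S i g (b l), b k⟫ := by
      rw [inner_sub_left (D k g), inner_sub_left (D l g)]
      linarith
    have h : ∀ k l, |⟪D k g - S i g (b k), b l⟫| ≤ φ i g * B := fun k l =>
      (abs_real_inner_le_norm _ _).trans
        (mul_le_mul (hφle i g k) (hBle l) (norm_nonneg _) (hφ0 i g))
    rw [heq]
    refine (abs_add_le _ _).trans ?_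
    linarith [h k l, h l k]
  have hkorn : ∑ k, ∑ l, ∑ c ∈ C, ⟪D k c, b l⟫ ^ 2 ≤
      d * d * (2 * B) ^ 2 * ∑ c ∈ C, φ i c ^ 2 := by
    refine (hC.sum_sq_difference_le hfper t hcomm b).trans ?_
    calc _ ≤ ∑ _k : Fin d, ∑ _l : Fin d, ∑ c ∈ C, (2 * B) ^ 2 * φ i c ^ 2 := by
          refine Finset.sum_le_sum fun k _ => Finset.sum_le_sum fun l _ =>
            Finset.sum_le_sum fun c _ => ?_
          rw [← mul_pow, ← sq_abs]
          exact pow_le_pow_left₀ (abs_nonneg _) (hsym k l c) 2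
      _ = _ := by
          simp only [← Finset.mul_sum, Finset.sum_const, Finset.card_univ, Fintype.card_fin,
            nsmul_eq_mul]
          ring
  -- S is recovered from the S b_k, each S b_k from D_k up to its error, and each D_k from its inner
  -- products with the spanning b_l.
  have hSle : ∀ g, ‖S i g‖ ≤ K₂ * (K₃ * ∑ k, ∑ l, |⟪D k g, b l⟫| + φ i g) := by
    intro g
    refine (hop _).trans (mul_le_mul_of_nonneg_left ?_ hK₂)
    rw [Finset.mul_sum, hφ, ← Finset.sum_add_distrib]
    refine Finset.sum_le_sum fun k _ => ?_
    have h := hinner (innerSL ℝ (D k g))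
    rw [innerSL_apply_norm] at h
    simp only [innerSL_apply_apply, Real.norm_eq_abs] at h
    have h' := norm_sub_le (D k g) (D k g - S i g (b k))
    rw [sub_sub_cancel] at h'
    exact h'.trans (add_le_add_left h _)
  have hsq : ∀ g, ‖S i g‖ ^ 2 ≤
      2 * K₂ ^ 2 * (K₃ ^ 2 * d * d * ∑ k, ∑ l, ⟪D k g, b l⟫ ^ 2 + φ i g ^ 2) := by
    intro g
    have h₁ : (∑ k, ∑ l, |⟪D k g, b l⟫|) ^ 2 ≤ d * d * ∑ k, ∑ l, ⟪D k g, b l⟫ ^ 2 := by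
      have h := sq_sum_le_card_mul_sum_sq (s := (Finset.univ : Finset (Fin d × Fin d)))
        (f := fun p => |⟪D p.1 g, b p.2⟫|)
      simpa [Fintype.sum_prod_type] using h
    have h₂ : ‖S i g‖ ^ 2 ≤ (K₂ * (K₃ * ∑ k, ∑ l, |⟪D k g, b l⟫| + φ i g)) ^ 2 :=
      pow_le_pow_left₀ (norm_nonneg _) (hSle g) 2
    have h₃ : (K₃ * ∑ k, ∑ l, |⟪D k g, b l⟫| + φ i g) ^ 2 ≤
        2 * ((K₃ * ∑ k, ∑ l, |⟪D k g, b l⟫|) ^ 2 + φ i g ^ 2) := add_sq_le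
    rw [mul_pow] at h₂ h₃
    have h₄ := mul_le_mul_of_nonneg_left h₁ (sq_nonneg K₃)
    have h₅ := mul_le_mul_of_nonneg_left h₃ (sq_nonneg K₂)
    have h₆ := mul_le_mul_of_nonneg_left h₄ (sq_nonneg K₂)
    linarith
  have hφsum := hsum H hN C i hC hper
  calc ∑ c ∈ C, ‖S i c‖ ^ 2
      ≤ ∑ c ∈ C, 2 * K₂ ^ 2 * (K₃ ^ 2 * d * d * ∑ k, ∑ l, ⟪D k c, b l⟫ ^ 2 + φ i c ^ 2) :=
        Finset.sum_le_sum fun c _ => hsq c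
    _ = 2 * K₂ ^ 2 * (K₃ ^ 2 * d * d * ∑ k, ∑ l, ∑ c ∈ C, ⟪D k c, b l⟫ ^ 2 +
          ∑ c ∈ C, φ i c ^ 2) := by
        rw [← Finset.mul_sum, Finset.sum_add_distrib, ← Finset.mul_sum, Finset.sum_comm]
        simp only [Finset.sum_comm (s := C)]
    _ ≤ 2 * K₂ ^ 2 * (K₃ ^ 2 * d * d * (d * d * (2 * B) ^ 2 * ∑ c ∈ C, φ i c ^ 2) +
          ∑ c ∈ C, φ i c ^ 2) := by gcongr
    _ = 2 * K₂ ^ 2 * (K₃ ^ 2 * d * d * (d * d * (2 * B) ^ 2) + 1) * ∑ c ∈ C, φ i c ^ 2 := by ring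
    _ ≤ _ := by
        rw [mul_assoc _ K₁]
        exact mul_le_mul_of_nonneg_left hφsum (by positivity)

/-- Write gth = gh(h⁻¹th); normality keeps the last factor in H. -/
theorem patch_mul_of_mem {H : Subgroup G} [H.Normal] {u : G → Vec d}
    (hu : ∀ g, ∀ t ∈ H, u (g * t) = u g) (R : Finset G) (g : G) {t : G} (ht : t ∈ H) :
    patch R u (g * t) = patch R u g := by
  unfold patch
  congr 1
  funext h
  have h' := hu (g * h.1) (h.1⁻¹ * t * h.1)
    (by simpa using ‹H.Normal›.conj_mem t ht h.1⁻¹)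
  rw [← h']
  congr 1
  group

/-- The discrete Korn inequality for a space group `G`. The subgroup `H₀` witnesses that the
translations have finite index. -/
theorem exists_sum_sq_nabla_le (hG : IsSpaceGroup G) {R : Finset G} (hR : Property2 x₀ R)
    {H₀ : Subgroup G} (hH₀ : ∀ t ∈ H₀, IsTranslation (t : Euc d)) {C₀ : Finset G}
    (hC₀ : IsTransversal H₀ C₀) :
    ∃ K : ℝ, 0 ≤ K ∧ ∀ (H : Subgroup G) (_ : H.Normal) (_ : ∀ t ∈ H, IsTranslation (t : Euc d))
      (C : Finset G) (u : G → Vec d), IsTransversal H C → (∀ g, ∀ t ∈ H, u (g * t) = u g) →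
      ∑ c ∈ C, ‖nabla R u c‖ ^ 2 ≤ K * ∑ c ∈ C, ‖projKer (Uiso x₀ R) (patch R u c)‖ ^ 2 := by
  choose S hskew hfit using fun (u : G → Vec d) (g : G) => exists_skew_approx x₀ hR.one_mem u g
  let e : (G → Vec d) → G → ℝ := fun u g => ‖projKer (Uiso x₀ R) (patch R u g)‖
  have he : ∀ u g, 0 ≤ e u g := fun u g => norm_nonneg _
  have hres : ∀ h ∈ R, Dominated e (residual x₀ labField S h) := fun h hh =>
    ((Dominated.refl e).const_mul zero_le_two).mono fun u g => hfit u g h hh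
  obtain ⟨R', R'', hR'1, hclos, hP, hsub⟩ := id hR
  have hmul : ∀ r ∈ R', ∀ h ∈ R'', r * h ∈ R := fun r hr h hh => hsub ⟨r, hr, h, hh, rfl⟩
  have hmem : ∀ r ∈ R', r ∈ R := fun r hr => by simpa using hmul r hr 1 hP.id_mem
  have hslow : ∀ r ∈ R', Dominated e fun u g => ‖S u (g * r) - S u g‖ := fun r hr =>
    dominated_norm_sub he (hP.span_eq_top hG) (hres r (hmem r hr))
      (fun h hh => hres h (by simpa using hmul 1 hR'1 h hh))
      (fun h hh => hres _ (hmul r hr h hh))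
  have hall := dominated_residual_of_closure he hclos (fun r hr => hres r (hmem r hr)) hslow
  obtain ⟨t, ht, hlin⟩ := hG.translations
  obtain ⟨K, hK, hKS⟩ := exists_sum_sq_skew_le he hskew (fun k => ⟨t k, (ht k).1⟩)
    (fun k => (ht k).2) hlin fun k => dominated_translate he hall hH₀ hC₀ (ht k).2
  set ρ : ℝ := ∑ h : R, ‖(h.1 : Euc d) x₀ - x₀‖ with hρ
  have hρ0 : 0 ≤ ρ := Finset.sum_nonneg fun _ _ => norm_nonneg _
  refine ⟨R.card * (8 + 2 * ρ ^ 2 * K), by positivity, fun H hN hH C u hC hu => ?_⟩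
  have hpt : ∀ g, ‖nabla R u g‖ ^ 2 ≤ R.card * (8 * e u g ^ 2 + 2 * ρ ^ 2 * ‖S u g‖ ^ 2) := by
    intro g
    rw [PiLp.norm_sq_eq_of_L2]
    calc _ ≤ ∑ _h : R, (8 * e u g ^ 2 + 2 * ρ ^ 2 * ‖S u g‖ ^ 2) := by
          refine Finset.sum_le_sum fun h _ => ?_
          rw [norm_nabla_apply]
          set a := labField u (g * h.1) - labField u g
          set x := ((g * h.1 : G) : Euc d) x₀ - (g : Euc d) x₀
          have h₁ : ‖a - S u g x‖ ≤ 2 * e u g := hfit u g h.1 h.2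
          have h₂ : ‖x‖ ≤ ρ := by
            rw [norm_apply_mul_sub]
            exact Finset.single_le_sum (f := fun h : R => ‖(h.1 : Euc d) x₀ - x₀‖)
              (fun _ _ => norm_nonneg _) (Finset.mem_univ h)
          have h₃ : ‖S u g x‖ ≤ ρ * ‖S u g‖ := by
            rw [mul_comm]
            exact (S u g).le_of_opNorm_le_of_le le_rfl h₂
          have h₄ : ‖a‖ ≤ 2 * e u g + ρ * ‖S u g‖ := by
            have := norm_add_le (a - S u g x) (S u g x)
            rw [sub_add_cancel] at this
            linarith
          calc ‖a‖ ^ 2 ≤ (2 * e u g + ρ * ‖S u g‖) ^ 2 :=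
                pow_le_pow_left₀ (norm_nonneg _) h₄ 2
            _ ≤ 2 * ((2 * e u g) ^ 2 + (ρ * ‖S u g‖) ^ 2) := add_sq_le
            _ = _ := by ring
      _ = _ := by
          rw [Finset.sum_const, Finset.card_univ, Fintype.card_coe, nsmul_eq_mul]
  have hS := hKS H hN C u hC
    (fun g s hs => by simp only [e, patch_mul_of_mem hu R g hs])
    -- Passing to the fixed frame preserves periodicity because the periods have trivial rotation.
    (fun g s hs => by
      have h1 : rot (s : Euc d) = 1 := hH s hs
      change rot ((g : Euc d) * (s : Euc d)) (u (g * s)) = rot (g : Euc d) (u g)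
      rw [rot_mul_apply, h1, hu g s hs]
      rfl)
  calc ∑ c ∈ C, ‖nabla R u c‖ ^ 2
      ≤ ∑ c ∈ C, R.card * (8 * e u c ^ 2 + 2 * ρ ^ 2 * ‖S u c‖ ^ 2) :=
        Finset.sum_le_sum fun c _ => hpt c
    _ = R.card * (8 * ∑ c ∈ C, e u c ^ 2 + 2 * ρ ^ 2 * ∑ c ∈ C, ‖S u c‖ ^ 2) := by
        simp only [Finset.mul_sum, Finset.sum_add_distrib, mul_add]
    _ ≤ R.card * (8 * ∑ c ∈ C, e u c ^ 2 + 2 * ρ ^ 2 * (K * ∑ c ∈ C, e u c ^ 2)) := by gcongr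
    _ = R.card * (8 + 2 * ρ ^ 2 * K) * ∑ c ∈ C, e u c ^ 2 := by ring

end Korn

/-! ### Comparison of quadratic means. -/

section MeanNorm

variable {Γ V W : Type*} [Norm V] [Norm W]

theorem meanNorm_le_mul_of_sum_sq_le {C : Finset Γ} {v : Γ → V} {w : Γ → W} {K : ℝ} (hK : 0 ≤ K)
    (h : ∑ c ∈ C, ‖v c‖ ^ 2 ≤ K * ∑ c ∈ C, ‖w c‖ ^ 2) :
    meanNorm C v ≤ Real.sqrt K * meanNorm C w := by
  rw [meanNorm, meanNorm, ← Real.sqrt_mul hK]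
  refine Real.sqrt_le_sqrt ?_
  rw [mul_left_comm]
  exact mul_le_mul_of_nonneg_left h (by positivity)

end MeanNorm

theorem meanNorm_mono {Γ V W : Type*} [SeminormedAddGroup V] [Norm W] {C : Finset Γ} {v : Γ → V}
    {w : Γ → W} (h : ∀ g, ‖v g‖ ≤ ‖w g‖) : meanNorm C v ≤ meanNorm C w :=
  Real.sqrt_le_sqrt <| mul_le_mul_of_nonneg_left
    (Finset.sum_le_sum fun c _ => pow_le_pow_left₀ (norm_nonneg _) (h c) 2) (by positivity)

theorem UrotOf_mono {d : ℕ} {G : Subgroup (Euc d)} {W W' : Submodule ℝ (Matrix (Fin d) (Fin d) ℝ)}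
    (h : W ≤ W') (x₀ : Vec d) (R : Finset G) : UrotOf W x₀ R ≤ UrotOf W' x₀ R :=
  fun _ ⟨A, hA, hu⟩ => ⟨A, h hA, hu⟩

end DiscreteKorn

open DiscreteKorn in
/-- Discrete Korn inequality for space groups: on periodic displacements the seminorms `‖·‖_R`,
`‖·‖_{R,0,0}` and `‖∇_R ·‖₂` are equivalent, with constants that depend neither on the period `N`
nor on the representation set `C` of `G / T^N`. -/
theorem mainTheorem3 {d d₁ d₂ : ℕ} (hd : d₁ + d₂ = d)
    (G : Subgroup (Euc d)) (S : Subgroup (Euc d₂)) (hGS : IsNormalForm hd G S)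
    (T : Set G) (hT : IsTranslationSection hd G S T)
    (hG : IsSpaceGroup G)
    (x₀ : Vec d) (hx₀ : Function.Injective fun g : G => (g : Euc d) x₀)
    (R : Finset G) (hR : Property2 x₀ R) :
    ∃ c K : ℝ, 0 < c ∧ 0 < K ∧
      ∀ N ∈ admissiblePeriods T, ∀ C : Finset G, IsRepresentationSet T N C →
        ∀ u : G → Vec d, IsPeriodic T N u →
          (c * rigidNorm00 hd x₀ R C u ≤ rigidNorm x₀ R C u ∧
            rigidNorm x₀ R C u ≤ K * rigidNorm00 hd x₀ R C u) ∧
          (c * gradNorm R C u ≤ rigidNorm x₀ R C u ∧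
            rigidNorm x₀ R C u ≤ K * gradNorm R C u) ∧
          (c * gradNorm R C u ≤ rigidNorm00 hd x₀ R C u ∧
            rigidNorm00 hd x₀ R C u ≤ K * gradNorm R C u) := by
  have hd₁ := hGS.eq_zero hd hG
  have hpow : ∀ N, ∀ t ∈ powSet T N, IsTranslation (t : Euc d) := by
    rintro N _ ⟨t, ht, rfl⟩
    exact (hT.isTranslation hd hd₁ ht).pow N
  obtain ⟨K, hK, hkorn⟩ : ∃ K : ℝ, 0 < K ∧ ∀ N ∈ admissiblePeriods T, ∀ C : Finset G,
      IsRepresentationSet T N C → ∀ u : G → Vec d, IsPeriodic T N u →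
      gradNorm R C u ≤ K * rigidNorm x₀ R C u := by
    -- A single period with a finite representation set supplies the finite-index translation
    -- subgroup on which the constant for all N is built; if there is none, the claim is vacuous.
    by_cases hex : ∃ N ∈ admissiblePeriods T, ∃ C : Finset G, IsRepresentationSet T N C
    · obtain ⟨N₀, ⟨-, H₀, -, hH₀⟩, C₀, hC₀⟩ := hex
      have hmem₀ : ∀ t, t ∈ H₀ ↔ t ∈ powSet T N₀ := fun t => Set.ext_iff.mp hH₀ t
      obtain ⟨K, hK, h⟩ := exists_sum_sq_nabla_le hG hR
        (fun t ht => hpow N₀ t ((hmem₀ t).mp ht)) (C₀ := C₀)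
        (fun g => by simpa only [hmem₀] using hC₀ g)
      -- Adding 1 makes the constant strictly positive, so that it can be inverted.
      refine ⟨Real.sqrt (K + 1), by positivity, ?_⟩
      rintro N ⟨-, H, hN, hH⟩ C hC u hu
      have hmem : ∀ t, t ∈ H ↔ t ∈ powSet T N := fun t => Set.ext_iff.mp hH t
      refine meanNorm_le_mul_of_sum_sq_le (by positivity)
        ((h H hN (fun t ht => hpow N t ((hmem t).mp ht)) C u
          (fun g => by simpa only [hmem] using hC g)
          (fun g t ht => hu g t ((hmem t).mp ht))).trans ?_)
      exact mul_le_mul_of_nonneg_right (by linarith) (Finset.sum_nonneg fun _ _ => sq_nonneg _)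
    · exact ⟨1, one_pos, fun N hN C hC => absurd ⟨N, hN, C, hC⟩ hex⟩
  have hmono : ∀ (C : Finset G) (u : G → Vec d),
      rigidNorm x₀ R C u ≤ rigidNorm00 hd x₀ R C u := fun C u =>
    meanNorm_mono fun g => norm_projKer_le_of_le
      (sup_le_sup_left (UrotOf_mono (skewZero_le_skew hd) x₀ R) _) _
  have hgrad : ∀ (C : Finset G) (u : G → Vec d), rigidNorm00 hd x₀ R C u ≤ gradNorm R C u :=
    fun C u => meanNorm_mono fun g => norm_projKer_patch_le_norm_nabla le_sup_left u g
  refine ⟨K⁻¹, 1, inv_pos.mpr hK, one_pos, fun N hN C hC u hu => ?_⟩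
  have h₁ := hmono C u
  have h₂ := hgrad C u
  have h₃ : K⁻¹ * gradNorm R C u ≤ rigidNorm x₀ R C u :=
    (inv_mul_le_iff₀ hK).mpr (hkorn N hN C hC u hu)
  have h₄ := mul_le_mul_of_nonneg_left h₂ (inv_pos.mpr hK).le
  simp only [one_mul]
  exact ⟨⟨h₄.trans h₃, h₁⟩, ⟨h₃, h₁.trans h₂⟩, ⟨h₃.trans h₁, h₂⟩⟩
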